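/- Let $N,k$ be integers with $3\le k<N$. For a symmetric $N\times N$ matrix $X$ let $\mathcal P_k^+(X)$ be the sum of its $k$ largest eigenvalues, counted with multiplicity. Let $0<\mu<\left(\frac{k-2}{2}\right)^2$ and $p>1$, and put $$\tau^{\pm}=\frac{k-2}{2}\pm\sqrt{\Big(\frac{k-2}{2}\Big)^2-\mu},\qquad p^\star=1+\frac{2}{\tau^+},\qquad p^{\star\star}=1+\frac{2}{\tau^-}.$$ Let $B(0,1)$ be the open unit ball of $\mathbb R^N$ and $r=|x|$. By a solution we mean a positive radial function $u=u(r)$ of class $C^2$ in $B(0,1)\setminus\{0\}$ such that $$\mathcal P_k^+(D^2u)+\mu\frac{u}{r^2}=u^p\qquad\text{in } B(0,1)\setminus\{0\}.$$ Then: 1. If $p<p^\star$, there are at least a solution $u$ with $r^{2/(p-1)}u(r)\to K$, at least a solution $v$ with $r^{\tau^+}v(r)\to c_1$, and at least a solution $w$ with $r^{\tau^-}w(r)\to c_2$ as $r\to0$, where $$K=\Big[\Big(\tfrac{2}{p-1}-\tau^+\Big)\Big(\tfrac{2}{p-1}-\tau^-\Big)\Big]^{1/(p-1)}$$ and $c_1,c_2>0$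 are suitable constants. 2. If $p^\star\le p<p^{\star\star}$, there is at least a solution $u$ with $r^{\tau^-}u(r)\to c_2$ as $r\to0$ for some constant $c_2>0$. 3. If $p=p^{\star\star}$, there is at least a solution $u$ with $$r^{\tau^-}(-\log r)^{\tau^- /2}u(r)\to \Big[\tau^-\sqrt{\big(\tfrac{k-2}{2}\big)^2-\mu}\Big]^{\tau^- /2}\qquad\text{as } r\to0.$$ 4. If $p>p^{\star\star}$, there is at least a solution $u$ with $r^{2/(p-1)}u(r)\to K$ as $r\to0$, with $K$ as in 1. -/

import Mathlib

open Filter Topology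

noncomputable section

/-- The truncated Laplacian `P_k^+`: the sum of the `k` largest eigenvalues, counted with
multiplicity, of a symmetric matrix. (`eigenvalues₀` lists the eigenvalues in decreasing order.) -/
def truncatedLaplacianPlus {N : ℕ} (k : ℕ) {X : Matrix (Fin N) (Fin N) ℝ}
    (hX : X.IsHermitian) : ℝ :=
  ∑ i with i.val < k, hX.eigenvalues₀ i

/-- The Hessian matrix `D²U(x)`, with entries `∂ᵢ ∂ⱼ U (x)`. -/
def hessianMatrix {N : ℕ} (U : EuclideanSpace ℝ (Fin N) → ℝ) (x : EuclideanSpace ℝ (Fin N)) :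
    Matrix (Fin N) (Fin N) ℝ :=
  Matrix.of fun i j =>
    fderiv ℝ (fun y => fderiv ℝ U y (EuclideanSpace.single j 1)) x (EuclideanSpace.single i 1)

/-- The punctured open unit ball of `ℝ^N`. -/
def puncturedBall (N : ℕ) : Set (EuclideanSpace ℝ (Fin N)) :=
  Metric.ball 0 1 \ {0}

/-- The radial function `x ↦ u(|x|)` is a positive solution of class `C²` of
`P_k^+(D²U) + μ U / |x|² = U^p` in the punctured unit ball of `ℝ^N`. The symmetry of the Hessian
demanded in `equation` is automatic for functions of class `C²`. -/
structure IsPositiveRadialSolution (N k : ℕ) (μ p : ℝ) (u : ℝ → ℝ) : Prop where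
  contDiffOn : ContDiffOn ℝ 2 (fun x : EuclideanSpace ℝ (Fin N) => u ‖x‖) (puncturedBall N)
  pos : ∀ x ∈ puncturedBall N, 0 < u ‖x‖
  equation : ∀ x ∈ puncturedBall N,
    ∃ hX : (hessianMatrix (fun y : EuclideanSpace ℝ (Fin N) => u ‖y‖) x).IsHermitian,
      truncatedLaplacianPlus k hX + μ * (u ‖x‖ / ‖x‖ ^ 2) = u ‖x‖ ^ p

/-- `τ⁺ = (k-2)/2 + √(((k-2)/2)² - μ)`. -/
def tauPlus (k : ℕ) (μ : ℝ) : ℝ :=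
  ((k : ℝ) - 2) / 2 + √((((k : ℝ) - 2) / 2) ^ 2 - μ)

/-- `τ⁻ = (k-2)/2 - √(((k-2)/2)² - μ)`. -/
def tauMinus (k : ℕ) (μ : ℝ) : ℝ :=
  ((k : ℝ) - 2) / 2 - √((((k : ℝ) - 2) / 2) ^ 2 - μ)

/-- `p⋆ = 1 + 2 / τ⁺`. -/
def pStar (k : ℕ) (μ : ℝ) : ℝ := 1 + 2 / tauPlus k μ

/-- `p⋆⋆ = 1 + 2 / τ⁻`. -/
def pStarStar (k : ℕ) (μ : ℝ) : ℝ := 1 + 2 / tauMinus k μ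

/-- `K = [(2/(p-1) - τ⁺) (2/(p-1) - τ⁻)]^{1/(p-1)}`. -/
def constK (k : ℕ) (μ p : ℝ) : ℝ :=
  ((2 / (p - 1) - tauPlus k μ) * (2 / (p - 1) - tauMinus k μ)) ^ (1 / (p - 1))

/-- `K̄ = [τ⁻ √(((k-2)/2)² - μ)]^{τ⁻/2}`. -/
def constKBar (k : ℕ) (μ : ℝ) : ℝ :=
  (tauMinus k μ * √((((k : ℝ) - 2) / 2) ^ 2 - μ)) ^ (tauMinus k μ / 2)

end

/-!
For a radial function `u(r)` the Hessian has the simple eigenvalue `u''` and the eigenvalue `u'/r`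
with multiplicity `N - 1`. As long as `u'' ≥ u'/r`, the equation is therefore the ordinary
differential equation `u'' + (k-1) u'/r + μ u/r² = u^p`, that is the radial equation of a Laplacian
in dimension `k` with a Hardy potential (`isPositiveRadialSolution_of_hasDerivAt`). With
`u(r) = r^{-τ} φ(t)` and `t = -log r` it becomes, on the half-line `t > 0`,

  `φ'' - (k-2-2τ) φ' + (τ-τ⁺)(τ-τ⁻) φ = e^{-(2-(p-1)τ)t} φ^p`,

and `u'' ≥ u'/r` holds as soon as `φ'` is small compared with `φ`
(`isPositiveRadialSolution_of_log`). Three choices of `τ` give all the solutions.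

* `τ = 2/(p-1)`: the equation is autonomous and the constant `φ = K` solves it whenever
  `(τ-τ⁺)(τ-τ⁻) > 0`.
* `τ = τ⁺` or `τ = τ⁻` with `(p-1)τ < 2`: the nonlinearity decays exponentially in `t`, and a
  perturbation of a constant solves the equation and converges as `t → ∞`
  (`exists_solution_tendsto_of_forcing`).
* `τ = τ⁻` with `(p-1)τ = 2`: the equation is `φ'' = d φ' + φ^p`, and the substitution
  `φ = w^{-τ/2}` turns the algebraically decaying solution into one with `w` asymptotically linear
  (`exists_solution_near_linear`, `tendsto_div_of_solution`).

The last two cases reduce to finding a bounded solution of `z' = l z + F[z]` on the real line,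
where `l ≠ 0` and `F` is a map on bounded continuous functions with Lipschitz constant less than
`|l|`. The linear equation `z' = l z + f` has a bounded solution of norm at most `‖f‖/|l|`, so the
contraction principle applies (`exists_bounded_solution_of_lipschitz`). The nonlinearity is
truncated to make it Lipschitz; the bounds on `z` show that the truncation is not active.
-/

/-! ### The truncated Laplacian of a radial function -/

open Matrix in
/-- A rank-one perturbation `a I + b x xᵀ` of a multiple of the identity, with `|x| = 1`, has no
eigenvalues besides `a` and `a + b`. -/
theorem eigenvalue_smul_one_add_rankOne {n : ℕ} {a b l : ℝ} {x v : Fin n → ℝ}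
    {M : Matrix (Fin n) (Fin n) ℝ} (hM : M = a • (1 : Matrix (Fin n) (Fin n) ℝ) + b • vecMulVec x x)
    (hx : x ⬝ᵥ x = 1) (hv : v ≠ 0) (h : M *ᵥ v = l • v) : l = a ∨ l = a + b := by
  have h1 : (l - a) • v = (b * (x ⬝ᵥ v)) • x := by
    rw [hM, add_mulVec, smul_mulVec, smul_mulVec, one_mulVec, vecMulVec_mulVec] at h
    rw [sub_smul, ← h]
    ext i
    simp
    ring
  have h2 : (l - a - b) * (x ⬝ᵥ v) = 0 := by
    have := congrArg (fun w => x ⬝ᵥ w) h1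
    simp only [dotProduct_smul, hx, smul_eq_mul] at this
    linarith
  rcases mul_eq_zero.1 h2 with h3 | h3
  · right; linarith
  · left
    rw [h3, mul_zero, zero_smul, smul_eq_zero] at h1
    have := h1.resolve_right hv
    linarith

open Matrix in
/-- The sum of the `k` largest eigenvalues of `a I + b x xᵀ`, where `|x| = 1` and `b ≥ 0`. The
trace shows that the eigenvalue `a + b` is simple unless `b = 0`. -/
theorem truncatedLaplacianPlus_smul_one_add_rankOne {n k : ℕ} (hk : 0 < k) (hkn : k ≤ n) {a b : ℝ}
    (hb : 0 ≤ b) {x : Fin n → ℝ} {M : Matrix (Fin n) (Fin n) ℝ}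
    (hM : M = a • (1 : Matrix (Fin n) (Fin n) ℝ) + b • vecMulVec x x)
    (hx : x ⬝ᵥ x = 1) (hH : M.IsHermitian) : truncatedLaplacianPlus k hH = k * a + b := by
  set e := Fintype.equivOfCardEq (Fintype.card_fin (Fintype.card (Fin n))) with he
  have hval : ∀ i, hH.eigenvalues₀ i = a ∨ hH.eigenvalues₀ i = a + b := by
    intro i
    have h := hH.mulVec_eigenvectorBasis (e i)
    have h0 : (hH.eigenvectorBasis (e i)).ofLp ≠ 0 := by
      intro h0
      have := hH.eigenvectorBasis.orthonormal.ne_zero (e i)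
      exact this (WithLp.ofLp_injective 2 h0)
    have h1 : hH.eigenvalues (e i) = hH.eigenvalues₀ i := by
      simp [Matrix.IsHermitian.eigenvalues, he]
    rw [h1] at h
    exact eigenvalue_smul_one_add_rankOne hM hx h0 h
  have htr : ∑ i, (hH.eigenvalues₀ i - a) = b := by
    have h1 : ∑ i, hH.eigenvalues₀ i = M.trace := by
      rw [hH.trace_eq_sum_eigenvalues, ← e.sum_comp]
      simp [Matrix.IsHermitian.eigenvalues, he]
    have h2 : M.trace = n * a + b := by
      rw [hM, trace_add, trace_smul, trace_smul, trace_one, trace_vecMulVec, hx]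
      simp [mul_comm]
    rw [Finset.sum_sub_distrib, h1, h2]
    simp
  have hnn : ∀ i, 0 ≤ hH.eigenvalues₀ i - a := by
    intro i
    rcases hval i with h | h <;> rw [h] <;> linarith
  have hcard : 0 < Fintype.card (Fin n) := by simp; omega
  have hrest : ∀ i, i ≠ ⟨0, hcard⟩ → hH.eigenvalues₀ i - a = 0 := by
    intro i hi
    rcases hval i with h | h
    · linarith
    · have h0 : hH.eigenvalues₀ i ≤ hH.eigenvalues₀ ⟨0, hcard⟩ :=
        hH.eigenvalues₀_antitone (Fin.mk_le_of_le_val (Nat.zero_le _))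
      have h2 := Finset.add_le_sum (s := Finset.univ) (fun j _ => hnn j) (Finset.mem_univ i)
        (Finset.mem_univ _) hi
      linarith [hnn i]
  have hzero : hH.eigenvalues₀ ⟨0, hcard⟩ - a = b := by
    rw [← htr, Finset.sum_eq_single ⟨0, hcard⟩ (fun i _ hi => hrest i hi) (by simp)]
  have hsum : ∑ i with i.val < k, (hH.eigenvalues₀ i - a) = b := by
    rw [Finset.sum_eq_single ⟨0, hcard⟩ (fun i _ hi => hrest i hi) (by simp [hk]), hzero]
  have hc : (Finset.univ.filter fun i : Fin (Fintype.card (Fin n)) => i.val < k).card = k := by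
    rw [Fin.card_filter_val_lt]
    simpa using hkn
  rw [Finset.sum_sub_distrib, Finset.sum_const, hc, nsmul_eq_mul] at hsum
  unfold truncatedLaplacianPlus
  linarith

theorem hasFDerivAt_norm_of_ne_zero {E : Type*} [NormedAddCommGroup E] [InnerProductSpace ℝ E]
    {x : E} (hx : x ≠ 0) : HasFDerivAt (fun y : E => ‖y‖) (‖x‖⁻¹ • innerSL ℝ x) x := by
  have h := (hasStrictFDerivAt_norm_sq x).hasFDerivAt.sqrt (by simpa using hx)
  simp only [Real.sqrt_sq (norm_nonneg _)] at h
  convert h using 1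
  ext v
  simp
  field_simp

theorem isOpen_puncturedBall (N : ℕ) : IsOpen (puncturedBall N) :=
  Metric.isOpen_ball.sdiff isClosed_singleton

theorem norm_mem_Ioo_of_mem_puncturedBall {N : ℕ} {x : EuclideanSpace ℝ (Fin N)}
    (hx : x ∈ puncturedBall N) : ‖x‖ ∈ Set.Ioo (0 : ℝ) 1 :=
  ⟨norm_pos_iff.2 hx.2, by simpa using hx.1⟩

/-- The Hessian of a radial function is `(u'/r) I + (u'' - u'/r) (x/r) (x/r)ᵀ`. -/
theorem hessianMatrix_radial {N : ℕ} {u u₁ u₂ : ℝ → ℝ}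
    (h₁ : ∀ r ∈ Set.Ioo (0 : ℝ) 1, HasDerivAt u (u₁ r) r)
    (h₂ : ∀ r ∈ Set.Ioo (0 : ℝ) 1, HasDerivAt u₁ (u₂ r) r)
    {x : EuclideanSpace ℝ (Fin N)} (hx : x ∈ puncturedBall N) :
    hessianMatrix (fun y : EuclideanSpace ℝ (Fin N) => u ‖y‖) x =
      (u₁ ‖x‖ / ‖x‖) • (1 : Matrix (Fin N) (Fin N) ℝ) +
        (u₂ ‖x‖ - u₁ ‖x‖ / ‖x‖) • Matrix.vecMulVec (fun i => x i / ‖x‖) (fun i => x i / ‖x‖) := by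
  have hr := norm_mem_Ioo_of_mem_puncturedBall hx
  have hr0 : ‖x‖ ≠ 0 := hr.1.ne'
  have hgrad : ∀ j, (fun y => fderiv ℝ (fun y : EuclideanSpace ℝ (Fin N) => u ‖y‖) y
      (EuclideanSpace.single j 1)) =ᶠ[𝓝 x] fun y => u₁ ‖y‖ * ‖y‖⁻¹ * y j := by
    intro j
    filter_upwards [(isOpen_puncturedBall N).mem_nhds hx] with y hy
    have hd := (h₁ _ (norm_mem_Ioo_of_mem_puncturedBall hy)).comp_hasFDerivAt y
      (hasFDerivAt_norm_of_ne_zero hy.2)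
    have hd' : HasFDerivAt (fun y : EuclideanSpace ℝ (Fin N) => u ‖y‖) _ y := hd
    rw [hd'.fderiv]
    simp [EuclideanSpace.inner_single_right]
    ring
  ext i j
  simp only [hessianMatrix, Matrix.of_apply]
  rw [(hgrad j).fderiv_eq]
  have hq : HasDerivAt (fun r => u₁ r * r⁻¹)
      (u₂ ‖x‖ * ‖x‖⁻¹ + u₁ ‖x‖ * (-(‖x‖ ^ 2)⁻¹)) ‖x‖ := (h₂ _ hr).mul (hasDerivAt_inv hr0)
  have hq' : HasFDerivAt (fun y : EuclideanSpace ℝ (Fin N) => u₁ ‖y‖ * ‖y‖⁻¹) _ x :=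
    hq.comp_hasFDerivAt x (hasFDerivAt_norm_of_ne_zero hx.2)
  have hp : HasFDerivAt (fun y : EuclideanSpace ℝ (Fin N) => y j)
      (EuclideanSpace.proj j : EuclideanSpace ℝ (Fin N) →L[ℝ] ℝ) x :=
    (EuclideanSpace.proj j : EuclideanSpace ℝ (Fin N) →L[ℝ] ℝ).hasFDerivAt
  have hqp : HasFDerivAt (fun y : EuclideanSpace ℝ (Fin N) => u₁ ‖y‖ * ‖y‖⁻¹ * y j) _ x :=
    hq'.mul hp
  rw [hqp.fderiv]
  simp [EuclideanSpace.inner_single_right, Matrix.vecMulVec_apply, Matrix.one_apply,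
    eq_comm (a := j)]
  split_ifs <;> field_simp <;> ring

theorem contDiffOn_two_of_hasDerivAt {s : Set ℝ} (hs : IsOpen s) {u u₁ u₂ : ℝ → ℝ}
    (h₁ : ∀ r ∈ s, HasDerivAt u (u₁ r) r) (h₂ : ∀ r ∈ s, HasDerivAt u₁ (u₂ r) r)
    (h₃ : ContinuousOn u₂ s) : ContDiffOn ℝ 2 u s := by
  have e₁ : Set.EqOn (deriv u) u₁ s := fun r hr => (h₁ r hr).deriv
  have e₂ : Set.EqOn (deriv u₁) u₂ s := fun r hr => (h₂ r hr).deriv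
  have c₁ : ContDiffOn ℝ 1 u₁ s := by
    have := (contDiffOn_succ_iff_deriv_of_isOpen (𝕜 := ℝ) (n := 0) (f := u₁) hs).2
      ⟨fun r hr => (h₂ r hr).differentiableAt.differentiableWithinAt, by simp,
        contDiffOn_zero.2 (h₃.congr e₂)⟩
    simpa using this
  have := (contDiffOn_succ_iff_deriv_of_isOpen (𝕜 := ℝ) (n := 1) (f := u) hs).2
      ⟨fun r hr => (h₁ r hr).differentiableAt.differentiableWithinAt, by simp, c₁.congr e₁⟩
  simpa [one_add_one_eq_two] using this

/-- Where `u'' ≥ u'/r`, the largest eigenvalue of the Hessian is `u''` and the others are `u'/r`,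
so that the equation reads `u'' + (k-1) u'/r + μ u/r² = u^p`. -/
theorem isPositiveRadialSolution_of_hasDerivAt {N k : ℕ} (hk : 0 < k) (hkN : k ≤ N) {μ p : ℝ}
    {u u₁ u₂ : ℝ → ℝ}
    (h₁ : ∀ r ∈ Set.Ioo (0 : ℝ) 1, HasDerivAt u (u₁ r) r)
    (h₂ : ∀ r ∈ Set.Ioo (0 : ℝ) 1, HasDerivAt u₁ (u₂ r) r)
    (h₃ : ContinuousOn u₂ (Set.Ioo 0 1))
    (hpos : ∀ r ∈ Set.Ioo (0 : ℝ) 1, 0 < u r)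
    (hle : ∀ r ∈ Set.Ioo (0 : ℝ) 1, u₁ r / r ≤ u₂ r)
    (heq : ∀ r ∈ Set.Ioo (0 : ℝ) 1,
      u₂ r + (k - 1) * (u₁ r / r) + μ * (u r / r ^ 2) = u r ^ p) :
    IsPositiveRadialSolution N k μ p u := by
  refine ⟨?_, fun x hx => hpos _ (norm_mem_Ioo_of_mem_puncturedBall hx), fun x hx => ?_⟩
  · refine (contDiffOn_two_of_hasDerivAt isOpen_Ioo h₁ h₂ h₃).comp
      (fun x hx => (contDiffAt_norm ℝ hx.2).contDiffWithinAt)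
      (fun x hx => norm_mem_Ioo_of_mem_puncturedBall hx)
  · have hr := norm_mem_Ioo_of_mem_puncturedBall hx
    have hM := hessianMatrix_radial h₁ h₂ hx
    have hH : (hessianMatrix (fun y : EuclideanSpace ℝ (Fin N) => u ‖y‖) x).IsHermitian := by
      rw [hM]
      ext i j
      simp [Matrix.vecMulVec_apply, Matrix.one_apply, eq_comm (a := i), mul_comm]
    refine ⟨hH, ?_⟩
    have hunit : (fun i => x i / ‖x‖) ⬝ᵥ (fun i => x i / ‖x‖) = 1 := by
      have h0 : ‖x‖ ^ 2 ≠ 0 := pow_ne_zero 2 hr.1.ne'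
      have h1 := EuclideanSpace.real_norm_sq_eq x
      have : ∀ i, x i / ‖x‖ * (x i / ‖x‖) = x i ^ 2 / ‖x‖ ^ 2 := fun i => by ring
      simp only [dotProduct, this]
      rw [← Finset.sum_div, ← h1, div_self h0]
    rw [truncatedLaplacianPlus_smul_one_add_rankOne hk hkN (sub_nonneg.2 (hle _ hr)) hM hunit hH,
      ← heq _ hr]
    ring

/-- The logarithmic change of variables `u(r) = r^{-τ} φ(t)`, `t = -log r`. -/
theorem isPositiveRadialSolution_of_log {N k : ℕ} (hk : 0 < k) (hkN : k ≤ N) {μ p τ : ℝ}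
    {φ φ₁ φ₂ : ℝ → ℝ}
    (h₁ : ∀ t, 0 < t → HasDerivAt φ (φ₁ t) t)
    (h₂ : ∀ t, 0 < t → HasDerivAt φ₁ (φ₂ t) t)
    (h₃ : ContinuousOn φ₂ (Set.Ioi 0))
    (hpos : ∀ t, 0 < t → 0 < φ t)
    (hle : ∀ t, 0 < t → 0 ≤ φ₂ t + (2 * τ + 2) * φ₁ t + (τ ^ 2 + 2 * τ) * φ t)
    (heq : ∀ t, 0 < t → φ₂ t - (k - 2 - 2 * τ) * φ₁ t + (τ ^ 2 - (k - 2) * τ + μ) * φ t =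
      Real.exp (-(2 - (p - 1) * τ) * t) * φ t ^ p) :
    IsPositiveRadialSolution N k μ p (fun r => r ^ (-τ) * φ (-Real.log r)) := by
  have ht : ∀ r ∈ Set.Ioo (0 : ℝ) 1, 0 < -Real.log r := fun r hr =>
    neg_pos.2 (Real.log_neg hr.1 hr.2)
  have hlog : ∀ r ∈ Set.Ioo (0 : ℝ) 1, HasDerivAt (fun r => -Real.log r) (-r⁻¹) r := fun r hr =>
    (Real.hasDerivAt_log hr.1.ne').neg
  have hs1 : ∀ (r a : ℝ), 0 < r → r ^ (a - 1) = r ^ a * r⁻¹ := fun r a hr => by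
    rw [Real.rpow_sub_one hr.ne', div_eq_mul_inv]
  refine isPositiveRadialSolution_of_hasDerivAt hk hkN
    (u₁ := fun r => r ^ (-τ - 1) * (-τ * φ (-Real.log r) - φ₁ (-Real.log r)))
    (u₂ := fun r => r ^ (-τ - 1 - 1) * (τ * (τ + 1) * φ (-Real.log r) +
      (2 * τ + 1) * φ₁ (-Real.log r) + φ₂ (-Real.log r))) ?_ ?_ ?_ ?_ ?_ ?_
  · intro r hr
    refine ((Real.hasDerivAt_rpow_const (Or.inl hr.1.ne')).mul
      ((h₁ _ (ht r hr)).comp r (hlog r hr))).congr_deriv ?_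
    simp only [hs1 _ _ hr.1, Function.comp]
    ring
  · intro r hr
    refine ((Real.hasDerivAt_rpow_const (Or.inl hr.1.ne')).mul
      ((((h₁ _ (ht r hr)).comp r (hlog r hr)).const_mul (-τ)).sub
        ((h₂ _ (ht r hr)).comp r (hlog r hr)))).congr_deriv ?_
    simp only [hs1 _ _ hr.1, Function.comp, Pi.sub_apply]
    ring
  · have hlc : ContinuousOn (fun r => -Real.log r) (Set.Ioo 0 1) := fun r hr =>
      (hlog r hr).continuousAt.continuousWithinAt
    have c0 : ContinuousOn φ (Set.Ioi 0) := fun t h =>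
      (h₁ t h).continuousAt.continuousWithinAt
    have c1 : ContinuousOn φ₁ (Set.Ioi 0) := fun t h =>
      (h₂ t h).continuousAt.continuousWithinAt
    have hm : Set.MapsTo (fun r => -Real.log r) (Set.Ioo 0 1) (Set.Ioi 0) := ht
    have d0 := c0.comp hlc hm
    have d1 := c1.comp hlc hm
    have d2 := h₃.comp hlc hm
    refine ContinuousOn.mul (fun r hr => ?_) ?_
    · exact (Real.continuousAt_rpow_const r _ (Or.inl hr.1.ne')).continuousWithinAt
    · exact ((d0.const_mul _).add (d1.const_mul _)).add d2
  · intro r hr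
    exact mul_pos (Real.rpow_pos_of_pos hr.1 _) (hpos _ (ht r hr))
  · intro r hr
    have h := mul_nonneg (Real.rpow_pos_of_pos hr.1 (-τ - 1 - 1)).le (hle _ (ht r hr))
    have h' := hs1 r (-τ - 1) hr.1
    rw [← sub_nonneg]
    refine h.trans_eq ?_
    simp only [h']
    ring
  · intro r hr
    have hφ := hpos _ (ht r hr)
    have hE := heq _ (ht r hr)
    have hexp : Real.exp (-(2 - (p - 1) * τ) * -Real.log r) = r ^ (2 - (p - 1) * τ) := by
      rw [Real.rpow_def_of_pos hr.1]
      ring_nf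
    have hpow : (r ^ (-τ) * φ (-Real.log r)) ^ p
        = r ^ (-τ - 1 - 1) * (r ^ (2 - (p - 1) * τ) * φ (-Real.log r) ^ p) := by
      rw [Real.mul_rpow (Real.rpow_pos_of_pos hr.1 _).le hφ.le, ← Real.rpow_mul hr.1.le,
        ← mul_assoc, ← Real.rpow_add hr.1]
      ring_nf
    rw [hexp] at hE
    simp only [hpow, ← hE, hs1 _ _ hr.1]
    ring

open scoped BoundedContinuousFunction

/-! ### Bounded solutions of `z' = l z + F[z]` -/

open MeasureTheory in
/-- For `l > 0` the bounded solution of `z' = l z + f` is `z(t) = -∫_t^∞ e^{l(t-s)} f(s) ds`. -/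
theorem exists_bounded_solution_of_pos {l : ℝ} (hl : 0 < l) :
    ∃ S : (ℝ →ᵇ ℝ) → (ℝ →ᵇ ℝ), (∀ f t, HasDerivAt (S f) (l * S f t + f t) t) ∧
      (∀ f, ‖S f‖ ≤ ‖f‖ / l) ∧ ∀ f g, S f - S g = S (f - g) := by
  have hl' : -l < 0 := by linarith
  have hint : ∀ (f : ℝ →ᵇ ℝ) (t : ℝ),
      IntegrableOn (fun s => Real.exp (-l * s) * f s) (Set.Ioi t) := by
    intro f t
    refine Integrable.mul_bdd (c := ‖f‖) (integrableOn_exp_mul_Ioi hl' t)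
      f.continuous.aestronglyMeasurable (Eventually.of_forall fun s => f.norm_coe_le_norm s)
  have hbd : ∀ (f : ℝ →ᵇ ℝ) (t : ℝ),
      ‖-(Real.exp (l * t) * ∫ s in Set.Ioi t, Real.exp (-l * s) * f s)‖ ≤ ‖f‖ / l := by
    intro f t
    have h1 : ‖∫ s in Set.Ioi t, Real.exp (-l * s) * f s‖ ≤
        ∫ s in Set.Ioi t, Real.exp (-l * s) * ‖f‖ := by
      refine norm_integral_le_of_norm_le ((integrableOn_exp_mul_Ioi hl' t).mul_const _)
        (Eventually.of_forall fun s => ?_)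
      rw [norm_mul, Real.norm_of_nonneg (Real.exp_pos _).le]
      exact mul_le_mul_of_nonneg_left (f.norm_coe_le_norm s) (Real.exp_pos _).le
    rw [integral_mul_const, integral_exp_mul_Ioi hl'] at h1
    rw [norm_neg, norm_mul, Real.norm_of_nonneg (Real.exp_pos _).le]
    refine (mul_le_mul_of_nonneg_left h1 (Real.exp_pos _).le).trans_eq ?_
    have : Real.exp (l * t) * Real.exp (-l * t) = 1 := by rw [← Real.exp_add]; simp
    rw [neg_div_neg_eq, div_mul_eq_mul_div, mul_div_assoc', ← mul_assoc, this, one_mul]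
  have hder : ∀ (f : ℝ →ᵇ ℝ) (t : ℝ),
      HasDerivAt (fun t => -(Real.exp (l * t) * ∫ s in Set.Ioi t, Real.exp (-l * s) * f s))
        (l * (-(Real.exp (l * t) * ∫ s in Set.Ioi t, Real.exp (-l * s) * f s)) + f t) t := by
    intro f t
    have hc : Continuous fun s => Real.exp (-l * s) * f s := by fun_prop
    have e : (fun t => ∫ s in Set.Ioi t, Real.exp (-l * s) * f s) = fun t =>
        (∫ s in Set.Ioi 0, Real.exp (-l * s) * f s) -
          ∫ s in (0 : ℝ)..t, Real.exp (-l * s) * f s := by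
      funext t
      rw [← intervalIntegral.integral_interval_add_Ioi (hint f 0) (hint f t)]
      ring
    have h1 : HasDerivAt (fun t => ∫ s in Set.Ioi t, Real.exp (-l * s) * f s)
        (-(Real.exp (-l * t) * f t)) t := by
      rw [e]
      exact (hc.integral_hasStrictDerivAt 0 t).hasDerivAt.const_sub _
    have h2 : HasDerivAt (fun t => Real.exp (l * t)) (Real.exp (l * t) * l) t := by
      simpa using ((hasDerivAt_id t).const_mul l).exp
    refine (h2.mul h1).neg.congr_deriv ?_
    have : Real.exp (l * t) * Real.exp (-l * t) = 1 := by rw [← Real.exp_add]; simp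
    linear_combination f t * this
  let S : (ℝ →ᵇ ℝ) → (ℝ →ᵇ ℝ) := fun f => BoundedContinuousFunction.ofNormedAddCommGroup
    (fun t => -(Real.exp (l * t) * ∫ s in Set.Ioi t, Real.exp (-l * s) * f s))
    (continuous_iff_continuousAt.2 fun t => (hder f t).continuousAt) (‖f‖ / l) (hbd f)
  refine ⟨S, hder, fun f => ?_, fun f g => ?_⟩
  · exact BoundedContinuousFunction.norm_ofNormedAddCommGroup_le _
      (div_nonneg (norm_nonneg _) hl.le) (hbd f)
  · ext t
    have : ∫ s in Set.Ioi t, Real.exp (-l * s) * (f - g) s =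
        (∫ s in Set.Ioi t, Real.exp (-l * s) * f s) -
          ∫ s in Set.Ioi t, Real.exp (-l * s) * g s := by
      rw [← integral_sub (hint f t) (hint g t)]
      simp [mul_sub]
    simp only [S, BoundedContinuousFunction.coe_sub, Pi.sub_apply,
      BoundedContinuousFunction.coe_ofNormedAddCommGroup] at this ⊢
    rw [this]
    ring

/-- For `l < 0` the bounded solution is obtained by reversing time. -/
theorem exists_bounded_solution {l : ℝ} (hl : l ≠ 0) :
    ∃ S : (ℝ →ᵇ ℝ) → (ℝ →ᵇ ℝ), (∀ f t, HasDerivAt (S f) (l * S f t + f t) t) ∧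
      (∀ f, ‖S f‖ ≤ ‖f‖ / |l|) ∧ ∀ f g, S f - S g = S (f - g) := by
  rcases lt_or_gt_of_ne hl with h | h
  · obtain ⟨S, h1, h2, h3⟩ := exists_bounded_solution_of_pos (neg_pos.2 h)
    let R : (ℝ →ᵇ ℝ) → (ℝ →ᵇ ℝ) := fun f => f.compContinuous ⟨fun t => -t, continuous_neg⟩
    have hR : ∀ f, ‖R f‖ ≤ ‖f‖ := fun f =>
      (BoundedContinuousFunction.norm_le (norm_nonneg f)).2 fun t => f.norm_coe_le_norm (-t)
    refine ⟨fun f => -R (S (R f)), fun f t => ?_, fun f => ?_, fun f g => ?_⟩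
    · have h4 := ((h1 (R f) (-t)).comp t (hasDerivAt_neg t)).neg
      refine h4.congr_deriv ?_
      have e1 : R f (-t) = f t := by simp [R]
      have e2 : R (S (R f)) t = S (R f) (-t) := rfl
      rw [e1, BoundedContinuousFunction.neg_apply, e2]
      ring
    · rw [norm_neg, abs_of_neg h]
      exact ((hR _).trans (h2 _)).trans
        (div_le_div_of_nonneg_right (hR f) (neg_pos.2 h).le)
    · have e : R f - R g = R (f - g) := rfl
      change -R (S (R f)) - -R (S (R g)) = -R (S (R (f - g)))
      rw [← e, ← h3]
      ext t
      simp [R]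
      ring
  · rw [abs_of_pos h]
    exact exists_bounded_solution_of_pos h

theorem exists_bounded_solution_of_lipschitz {l : ℝ} (hl : l ≠ 0)
    {F : (ℝ →ᵇ ℝ) → (ℝ →ᵇ ℝ)} {L : ℝ} (hL : L < |l|)
    (hF : ∀ f g, ‖F f - F g‖ ≤ L * ‖f - g‖) :
    ∃ z : ℝ →ᵇ ℝ, (∀ t, HasDerivAt z (l * z t + F z t) t) ∧ ‖z‖ ≤ ‖F z‖ / |l| := by
  obtain ⟨S, h1, h2, h3⟩ := exists_bounded_solution hl
  have hl0 : 0 < |l| := abs_pos.2 hl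
  have hc : ContractingWith (Real.toNNReal (L / |l|)) fun z => S (F z) := by
    refine ⟨?_, LipschitzWith.of_dist_le_mul fun f g => ?_⟩
    · rw [← NNReal.coe_lt_coe, NNReal.coe_one, Real.coe_toNNReal', max_lt_iff]
      exact ⟨(div_lt_one hl0).2 hL, one_pos⟩
    · rw [dist_eq_norm, dist_eq_norm, h3]
      calc ‖S (F f - F g)‖ ≤ ‖F f - F g‖ / |l| := h2 _
        _ ≤ L * ‖f - g‖ / |l| := div_le_div_of_nonneg_right (hF f g) hl0.le
        _ = L / |l| * ‖f - g‖ := by ring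
        _ ≤ _ := mul_le_mul_of_nonneg_right (Real.le_coe_toNNReal _) (norm_nonneg _)
  have hz : S (F (hc.fixedPoint _)) = hc.fixedPoint _ := hc.fixedPoint_isFixedPt
  refine ⟨hc.fixedPoint _, fun t => ?_, ?_⟩
  · have := h1 (F (hc.fixedPoint _)) t
    rwa [hz] at this
  · have := h2 (F (hc.fixedPoint _))
    rwa [hz] at this

/-! ### Solutions asymptotic to `r^{-τ}` -/

theorem abs_projIcc_sub_projIcc_le {a b : ℝ} (h : a ≤ b) (x y : ℝ) :
    |(Set.projIcc a b h x : ℝ) - Set.projIcc a b h y| ≤ |x - y| := by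
  simpa [Subtype.dist_eq, Real.dist_eq] using (LipschitzWith.projIcc h).dist_le_mul x y

theorem abs_rpow_sub_rpow_le {p M : ℝ} (hp : 1 ≤ p) {x y : ℝ} (hx : x ∈ Set.Icc 0 M)
    (hy : y ∈ Set.Icc 0 M) : |x ^ p - y ^ p| ≤ p * M ^ (p - 1) * |x - y| := by
  have h := Convex.norm_image_sub_le_of_norm_hasDerivWithin_le (f := fun x : ℝ => x ^ p)
    (f' := fun x : ℝ => p * x ^ (p - 1)) (C := p * M ^ (p - 1)) (s := Set.Icc 0 M)
    (fun z _ => (Real.hasDerivAt_rpow_const (Or.inr hp)).hasDerivWithinAt)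
    (fun z hz => ?_) (convex_Icc 0 M) hy hx
  · simpa [Real.norm_eq_abs] using h
  · have h0 : 0 ≤ p := by linarith
    rw [Real.norm_of_nonneg (mul_nonneg h0 (Real.rpow_nonneg hz.1 _))]
    exact mul_le_mul_of_nonneg_left (Real.rpow_le_rpow hz.1 hz.2 (by linarith)) h0

theorem integrableOn_exp_neg_mul_boundedContinuousFunction {η : ℝ} (hη : 0 < η) (z : ℝ →ᵇ ℝ) :
    MeasureTheory.IntegrableOn (fun s => Real.exp (-η * s) * z s) (Set.Ioi 0) :=
  MeasureTheory.Integrable.mul_bdd (c := ‖z‖) (integrableOn_exp_mul_Ioi (neg_lt_zero.2 hη) 0)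
    z.continuous.aestronglyMeasurable (Eventually.of_forall fun s => z.norm_coe_le_norm s)

theorem abs_integral_exp_neg_mul_le {η : ℝ} (hη : 0 < η) (z : ℝ →ᵇ ℝ) {t : ℝ} (ht : 0 ≤ t) :
    |∫ s in (0 : ℝ)..t, Real.exp (-η * s) * z s| ≤ ‖z‖ / η := by
  have hd : ∀ s ∈ Set.uIcc 0 t, HasDerivAt (fun s => -(Real.exp (-η * s) * ‖z‖ / η))
      (Real.exp (-η * s) * ‖z‖) s := by
    intro s _
    have h1 : HasDerivAt (fun s => Real.exp (-η * s)) (Real.exp (-η * s) * -η) s := by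
      simpa using ((hasDerivAt_id s).const_mul (-η)).exp
    refine ((h1.mul_const ‖z‖).div_const η).neg.congr_deriv ?_
    field_simp
  have hc : Continuous fun s => Real.exp (-η * s) * ‖z‖ := by fun_prop
  have h1 := intervalIntegral.norm_integral_le_of_norm_le (μ := MeasureTheory.volume)
    (f := fun s => Real.exp (-η * s) * z s)
    (g := fun s => Real.exp (-η * s) * ‖z‖) ht (Eventually.of_forall fun s _ => ?_)
    (hc.intervalIntegrable 0 t)
  · rw [intervalIntegral.integral_eq_sub_of_hasDerivAt hd (hc.intervalIntegrable 0 t)] at h1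
    refine h1.trans ?_
    have : 0 ≤ Real.exp (-η * t) * ‖z‖ / η := by positivity
    rw [mul_zero, Real.exp_zero, one_mul]
    linarith
  · rw [norm_mul, Real.norm_of_nonneg (Real.exp_pos _).le]
    exact mul_le_mul_of_nonneg_left (z.norm_coe_le_norm s) (Real.exp_pos _).le

theorem integral_exp_neg_mul_sub (η : ℝ) (z y : ℝ →ᵇ ℝ) (t : ℝ) :
    (∫ s in (0 : ℝ)..t, Real.exp (-η * s) * z s) - ∫ s in (0 : ℝ)..t, Real.exp (-η * s) * y s =
      ∫ s in (0 : ℝ)..t, Real.exp (-η * s) * (z - y) s := by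
  rw [← intervalIntegral.integral_sub (Continuous.intervalIntegrable (by fun_prop) _ _)
    (Continuous.intervalIntegrable (by fun_prop) _ _)]
  simp [mul_sub]

/-- Writing `φ' = ε e^{-ηt} z` turns the equation `φ'' = D φ' + ε e^{-βt} φ^p` into
`z' = (D + η) z + e^{-(β-η)t} φ^p`, which for small `ε` has a bounded solution with `φ(0) = 1`,
whatever the sign of `D`. -/
theorem exists_solution_tendsto_of_forcing (D : ℝ) {β p δ : ℝ} (hβ : 0 < β) (hp : 1 ≤ p)
    (hδ : 0 < δ) :
    ∃ ε > 0, ∃ φ φ₁ : ℝ → ℝ, (∀ t, 0 < t → HasDerivAt φ (φ₁ t) t) ∧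
      (∀ t, 0 < t → HasDerivAt φ₁ (D * φ₁ t + ε * (Real.exp (-β * t) * φ t ^ p)) t) ∧
      (∀ t, 0 < t → 1 / 2 ≤ φ t) ∧ (∀ t, 0 < t → |φ₁ t| ≤ δ) ∧
      ∃ c > 0, Tendsto φ atTop (𝓝 c) := by
  -- Any weight `η ∈ (0, β]` for which `D + η` does not vanish will do.
  obtain ⟨η, hη, hηβ, hl⟩ : ∃ η, 0 < η ∧ η ≤ β ∧ D + η ≠ 0 := by
    by_cases h : D + β = 0
    · exact ⟨β / 2, by linarith, by linarith, fun h' => by linarith⟩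
    · exact ⟨β, hβ, le_rfl, h⟩
  set l := D + η with hldef
  have hl0 : 0 < |l| := abs_pos.2 hl
  set B : ℝ := (3 / 2) ^ p with hB
  have hB0 : 0 < B := by positivity
  set L : ℝ := p * (3 / 2) ^ (p - 1) with hL
  obtain ⟨ε, hε1, hε2, hε3, hε⟩ : ∃ ε : ℝ, ε * (B / |l| / η) < 1 / 2 ∧ ε * (B / |l|) < δ ∧
      ε * (L / η) < |l| ∧ 0 < ε := by
    have key : ∀ a b : ℝ, 0 < b → ∀ᶠ ε in 𝓝[>] (0 : ℝ), ε * a < b := by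
      intro a b hb
      have h : Tendsto (fun ε : ℝ => ε * a) (𝓝[>] 0) (𝓝 0) :=
        ((continuous_mul_const a).tendsto' 0 0 (by simp)).mono_left nhdsWithin_le_nhds
      exact h.eventually (gt_mem_nhds hb)
    exact ((key _ _ one_half_pos).and ((key _ _ hδ).and ((key _ _ hl0).and
      self_mem_nhdsWithin))).exists
  have h13 : (1 / 2 : ℝ) ≤ 3 / 2 := by norm_num
  let I : (ℝ →ᵇ ℝ) → ℝ → ℝ := fun z t => ∫ s in (0 : ℝ)..t, Real.exp (-η * s) * z s
  have hIc : ∀ z, Continuous (I z) := fun z =>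
    intervalIntegral.continuous_primitive
      (fun a b => Continuous.intervalIntegrable (by fun_prop) a b) 0
  let P : (ℝ →ᵇ ℝ) → ℝ → ℝ := fun z t =>
    (Set.projIcc (1 / 2) (3 / 2) h13 (1 + ε * I z (max t 0)) : ℝ)
  have hPc : ∀ z, Continuous (P z) := fun z =>
    continuous_subtype_val.comp (continuous_projIcc.comp
      (by have := hIc z; fun_prop))
  have hPmem : ∀ z t, P z t ∈ Set.Icc (1 / 2 : ℝ) (3 / 2) := fun z t => Subtype.prop _
  have hPmem' : ∀ z t, P z t ∈ Set.Icc (0 : ℝ) (3 / 2) := fun z t =>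
    ⟨by linarith [(hPmem z t).1], (hPmem z t).2⟩
  have hexp : ∀ t : ℝ, Real.exp (-(β - η) * max t 0) ≤ 1 := fun t => by
    rw [Real.exp_le_one_iff]
    exact mul_nonpos_of_nonpos_of_nonneg (by linarith) (le_max_right _ _)
  have hFb : ∀ z t, ‖Real.exp (-(β - η) * max t 0) * P z t ^ p‖ ≤ B := by
    intro z t
    rw [norm_mul, Real.norm_of_nonneg (Real.exp_pos _).le,
      Real.norm_of_nonneg (Real.rpow_nonneg (hPmem' z t).1 _)]
    refine (mul_le_of_le_one_left (Real.rpow_nonneg (hPmem' z t).1 _) (hexp t)).trans ?_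
    exact Real.rpow_le_rpow (hPmem' z t).1 (hPmem' z t).2 (by linarith)
  let F : (ℝ →ᵇ ℝ) → (ℝ →ᵇ ℝ) := fun z => BoundedContinuousFunction.ofNormedAddCommGroup
    (fun t => Real.exp (-(β - η) * max t 0) * P z t ^ p)
    (by
      have h1 := (hPc z).rpow_const (p := p) fun t => Or.inr (by linarith)
      fun_prop) B (hFb z)
  have hFlip : ∀ z y, ‖F z - F y‖ ≤ ε * (L / η) * ‖z - y‖ := by
    intro z y
    have hL0 : 0 ≤ L := mul_nonneg (by linarith) (Real.rpow_nonneg (by norm_num) _)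
    refine (BoundedContinuousFunction.norm_le (by positivity)).2 fun t => ?_
    have e : (F z - F y) t = Real.exp (-(β - η) * max t 0) * (P z t ^ p - P y t ^ p) := by
      simp only [F, BoundedContinuousFunction.coe_sub, Pi.sub_apply,
        BoundedContinuousFunction.coe_ofNormedAddCommGroup]
      ring
    rw [e, norm_mul, Real.norm_of_nonneg (Real.exp_pos _).le]
    refine (mul_le_of_le_one_left (norm_nonneg _) (hexp t)).trans ?_
    refine (abs_rpow_sub_rpow_le hp (hPmem' z t) (hPmem' y t)).trans ?_
    have h1 : |P z t - P y t| ≤ ε * (‖z - y‖ / η) := by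
      refine (abs_projIcc_sub_projIcc_le h13 _ _).trans ?_
      have : (1 + ε * I z (max t 0)) - (1 + ε * I y (max t 0)) =
          ε * (I z (max t 0) - I y (max t 0)) := by ring
      rw [this, integral_exp_neg_mul_sub, abs_mul, abs_of_pos hε]
      exact mul_le_mul_of_nonneg_left (abs_integral_exp_neg_mul_le hη _ (le_max_right _ _)) hε.le
    refine (mul_le_mul_of_nonneg_left h1 hL0).trans_eq ?_
    ring
  obtain ⟨z, hz, hzn⟩ := exists_bounded_solution_of_lipschitz hl hε3 hFlip
  have hzB : ‖z‖ ≤ B / |l| := hzn.trans (div_le_div_of_nonneg_right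
    (BoundedContinuousFunction.norm_ofNormedAddCommGroup_le _ hB0.le (hFb z)) hl0.le)
  have hφ : ∀ t, 0 ≤ t → |ε * I z t| ≤ 1 / 2 := by
    intro t ht
    rw [abs_mul, abs_of_pos hε]
    refine (mul_le_mul_of_nonneg_left ((abs_integral_exp_neg_mul_le hη z ht).trans
      (div_le_div_of_nonneg_right hzB hη.le)) hε.le).trans hε1.le
  have hge : ∀ t, 0 < t → 1 / 2 ≤ 1 + ε * I z t := fun t ht => by
    linarith [(abs_le.1 (hφ t ht.le)).1]
  have hP : ∀ t, 0 < t → P z t = 1 + ε * I z t := by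
    intro t ht
    have h := abs_le.1 (hφ t ht.le)
    simp only [P, max_eq_left ht.le]
    rw [Set.projIcc_of_mem h13 ⟨by linarith, by linarith⟩]
  refine ⟨ε, hε, fun t => 1 + ε * I z t, fun t => ε * (Real.exp (-η * t) * z t), ?_, ?_, hge, ?_,
    ?_⟩
  · intro t _
    have hc : Continuous fun s => Real.exp (-η * s) * z s := by fun_prop
    exact ((hc.integral_hasStrictDerivAt 0 t).hasDerivAt.const_mul ε).const_add 1
  · intro t ht
    have h1 : HasDerivAt (fun s => Real.exp (-η * s)) (Real.exp (-η * t) * -η) t := by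
      simpa using ((hasDerivAt_id t).const_mul (-η)).exp
    refine ((h1.mul (hz t)).const_mul ε).congr_deriv ?_
    have e1 : F z t = Real.exp (-(β - η) * t) * (1 + ε * I z t) ^ p := by
      simp only [F, BoundedContinuousFunction.coe_ofNormedAddCommGroup, hP t ht, max_eq_left ht.le]
    have e2 : Real.exp (-β * t) = Real.exp (-η * t) * Real.exp (-(β - η) * t) := by
      rw [← Real.exp_add]
      ring_nf
    rw [e1, e2]
    simp only [hldef]
    ring
  · intro t ht
    rw [abs_mul, abs_mul, abs_of_pos hε, abs_of_pos (Real.exp_pos _)]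
    refine le_trans (mul_le_mul_of_nonneg_left ?_ hε.le) hε2.le
    refine (mul_le_of_le_one_left (abs_nonneg _) ?_).trans ((z.norm_coe_le_norm t).trans hzB)
    rw [Real.exp_le_one_iff]
    nlinarith
  · have hlim : Tendsto (fun t => 1 + ε * I z t) atTop
        (𝓝 (1 + ε * ∫ s in Set.Ioi (0 : ℝ), Real.exp (-η * s) * z s)) :=
      ((MeasureTheory.intervalIntegral_tendsto_integral_Ioi 0
        (integrableOn_exp_neg_mul_boundedContinuousFunction hη z) tendsto_id).const_mul
          ε).const_add 1
    refine ⟨_, ?_, hlim⟩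
    have : (1 / 2 : ℝ) ≤ _ := ge_of_tendsto hlim ((eventually_gt_atTop 0).mono hge)
    linarith

theorem tendsto_neg_log_nhdsGT_zero : Tendsto (fun r : ℝ => -Real.log r) (𝓝[>] 0) atTop :=
  tendsto_neg_atBot_atTop.comp Real.tendsto_log_nhdsGT_zero

/-- A root `τ > 0` of the indicial equation below the exponent `2 / (p - 1)` of the homogeneous
solution is the rate of some positive radial solution. -/
theorem exists_isPositiveRadialSolution_rate {N k : ℕ} (hk : 0 < k) (hkN : k ≤ N) {μ p τ : ℝ}
    (hp : 1 < p) (hτ : 0 < τ) (hroot : τ ^ 2 - (k - 2) * τ + μ = 0) (hβ : (p - 1) * τ < 2) :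
    ∃ (u : ℝ → ℝ) (c : ℝ), IsPositiveRadialSolution N k μ p u ∧ 0 < c ∧
      Tendsto (fun r : ℝ => r ^ τ * u r) (𝓝[>] 0) (𝓝 c) := by
  set D : ℝ := k - 2 - 2 * τ with hD
  have hM : 0 < |D + (2 * τ + 2)| + 1 := by positivity
  -- `δ` is small enough for `u'' ≥ u'/r` to follow from `|φ'| ≤ δ` and `φ ≥ 1/2`.
  set δ : ℝ := (τ ^ 2 + 2 * τ) * (1 / 2) / (|D + (2 * τ + 2)| + 1) with hδ
  obtain ⟨ε, hε, φ, φ₁, h1, h2, h3, h4, c, hc, h5⟩ :=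
    exists_solution_tendsto_of_forcing D (β := 2 - (p - 1) * τ) (by linarith) hp.le
      (show 0 < δ by positivity)
  -- The factor `A` removes the parameter `ε` from the equation.
  set A : ℝ := ε ^ (1 / (p - 1)) with hA
  have hA0 : 0 < A := Real.rpow_pos_of_pos hε _
  have hAp : A ^ p = A * ε := by
    have hp1 : p - 1 ≠ 0 := by linarith
    rw [hA, ← Real.rpow_mul hε.le]
    nth_rewrite 3 [← Real.rpow_one ε]
    rw [← Real.rpow_add hε]
    congr 1
    field_simp
    ring
  have hsol : IsPositiveRadialSolution N k μ p (fun r => r ^ (-τ) * (A * φ (-Real.log r))) := by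
    refine isPositiveRadialSolution_of_log hk hkN (φ := fun t => A * φ t)
      (φ₁ := fun t => A * φ₁ t) (φ₂ := fun t => A * (D * φ₁ t + ε *
        (Real.exp (-(2 - (p - 1) * τ) * t) * φ t ^ p))) ?_ ?_ ?_ ?_ ?_ ?_
    · exact fun t ht => (h1 t ht).const_mul A
    · exact fun t ht => (h2 t ht).const_mul A
    · have c0 : ContinuousOn φ (Set.Ioi 0) := fun t h =>
        (h1 t h).continuousAt.continuousWithinAt
      have c1 : ContinuousOn φ₁ (Set.Ioi 0) := fun t h =>
        (h2 t h).continuousAt.continuousWithinAt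
      have c2 : ContinuousOn (fun t => φ t ^ p) (Set.Ioi 0) :=
        c0.rpow_const fun t _ => Or.inr (by linarith)
      have c3 : Continuous fun t => Real.exp (-(2 - (p - 1) * τ) * t) := by fun_prop
      exact continuousOn_const.mul ((continuousOn_const.mul c1).add
        (continuousOn_const.mul (c3.continuousOn.mul c2)))
    · exact fun t ht => mul_pos hA0 (by linarith [h3 t ht])
    · intro t ht
      have hφ : 0 < φ t := by linarith [h3 t ht]
      have e1 : 0 ≤ ε * (Real.exp (-(2 - (p - 1) * τ) * t) * φ t ^ p) := by positivity
      have e2 : |(D + (2 * τ + 2)) * φ₁ t| ≤ (τ ^ 2 + 2 * τ) * (1 / 2) := by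
        rw [abs_mul]
        calc |D + (2 * τ + 2)| * |φ₁ t| ≤ (|D + (2 * τ + 2)| + 1) * δ :=
              mul_le_mul (by linarith) (h4 t ht) (abs_nonneg _) hM.le
          _ = _ := by rw [hδ]; field_simp
      have e3 : (τ ^ 2 + 2 * τ) * (1 / 2) ≤ (τ ^ 2 + 2 * τ) * φ t :=
        mul_le_mul_of_nonneg_left (h3 t ht) (by positivity)
      have e4 := (abs_le.1 e2).1
      have : 0 ≤ A * ((D + (2 * τ + 2)) * φ₁ t + (τ ^ 2 + 2 * τ) * φ t +
          ε * (Real.exp (-(2 - (p - 1) * τ) * t) * φ t ^ p)) :=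
        mul_nonneg hA0.le (by linarith)
      refine this.trans_eq ?_
      ring
    · intro t ht
      have hφ : 0 < φ t := by linarith [h3 t ht]
      rw [hroot, Real.mul_rpow hA0.le hφ.le, hAp]
      ring
  refine ⟨_, A * c, hsol, mul_pos hA0 hc, ?_⟩
  refine ((h5.comp tendsto_neg_log_nhdsGT_zero).const_mul A).congr' ?_
  filter_upwards [self_mem_nhdsWithin] with r hr
  have : r ^ τ * r ^ (-τ) = 1 := by
    rw [← Real.rpow_add hr]
    simp
  simp only [Function.comp]
  rw [← mul_assoc, this, one_mul]

/-! ### The critical exponent -/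

/-- A quotient `h²/w`, with `h ∈ [c/2, 2c]` and `w ≥ w₀ + (c/2) t`, depends on `(h, w)` with a
Lipschitz constant of order `1/w₀` even when `w` varies by as much as `t` times the variation of
`h`. -/
theorem abs_sq_div_sub_sq_div_le {c w₀ t e h h' w w' : ℝ} (hc : 0 < c) (hw₀ : 0 < w₀)
    (ht : 0 ≤ t) (hh : h ∈ Set.Icc (c / 2) (2 * c)) (hh' : h' ∈ Set.Icc (c / 2) (2 * c))
    (hw : w₀ + c / 2 * t ≤ w) (hw' : w₀ + c / 2 * t ≤ w') (he : |h - h'| ≤ e)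
    (hd : |w - w'| ≤ e * t) : |h ^ 2 / w - h' ^ 2 / w'| ≤ 12 * c / w₀ * e := by
  have hct : 0 ≤ c / 2 * t := by positivity
  have hw0 : 0 < w := by linarith
  have hw0' : 0 < w' := by linarith
  have he0 : 0 ≤ e := (abs_nonneg _).trans he
  have e1 : h ^ 2 / w - h' ^ 2 / w' = (h + h') * (h - h') / w + h' ^ 2 * (w' - w) / (w * w') := by
    field_simp
    ring
  have e2 : |(h + h') * (h - h') / w| ≤ 4 * c / w₀ * e := by
    rw [abs_div, abs_mul, abs_of_pos hw0, abs_of_pos (show 0 < h + h' by linarith [hh.1, hh'.1])]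
    calc (h + h') * |h - h'| / w ≤ 4 * c * e / w₀ := by
          refine div_le_div₀ (by positivity) ?_ hw₀ (by linarith)
          exact mul_le_mul (by linarith [hh.2, hh'.2]) he (abs_nonneg _) (by positivity)
      _ = _ := by ring
  have e3 : |h' ^ 2 * (w' - w) / (w * w')| ≤ 8 * c / w₀ * e := by
    rw [abs_div, abs_mul, abs_of_pos (mul_pos hw0 hw0'), abs_of_nonneg (sq_nonneg h'),
      div_le_iff₀ (mul_pos hw0 hw0'), abs_sub_comm]
    have h1 : h' ^ 2 * |w - w'| ≤ (2 * c) ^ 2 * (e * t) :=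
      mul_le_mul (pow_le_pow_left₀ (by linarith [hh'.1]) hh'.2 2) hd (abs_nonneg _) (sq_nonneg _)
    have h2 : w₀ * (c / 2 * t) ≤ w * w' :=
      mul_le_mul (by linarith) (by linarith) hct hw0.le
    calc h' ^ 2 * |w - w'| ≤ (2 * c) ^ 2 * (e * t) := h1
      _ = 8 * c / w₀ * e * (w₀ * (c / 2 * t)) := by field_simp; ring
      _ ≤ _ := mul_le_mul_of_nonneg_left h2 (by positivity)
  rw [e1]
  refine (abs_add_le _ _).trans ((add_le_add e2 e3).trans_eq ?_)
  ring

/-- A solution of `w'' = d w' - 1/m + (m+1) w'²/w` with slope near `1/(dm)`: with `w' = c + z` and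
`c = 1/(dm)` the equation becomes `z' = d z + (m+1) (c+z)²/w`, whose last term is small and
contracting if `w(0)` is large. -/
theorem exists_solution_near_linear {d m δ : ℝ} (hd : 0 < d) (hm : 0 < m) (hδ : 0 < δ) :
    ∃ w q : ℝ → ℝ, (∀ t, 0 < t → HasDerivAt w (q t) t) ∧
      (∀ t, 0 < t → HasDerivAt q (d * q t - 1 / m + (m + 1) * (q t ^ 2 / w t)) t) ∧
      (∀ t, 0 < t → 0 < w t) ∧ (∀ t, 0 < t → 0 < q t) ∧
      (∀ t, 0 < t → q t ≤ 2 * (1 / (d * m))) ∧ ∀ t, 0 < t → q t ≤ δ * w t := by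
  set c : ℝ := 1 / (d * m) with hcdef
  have hc : 0 < c := by positivity
  obtain ⟨w₀, hw1, hw2, hw3, hw₀⟩ : ∃ w₀ : ℝ, (m + 1) * (4 * c ^ 2) / (d * (c / 2)) < w₀ ∧
      (m + 1) * (12 * c) / d < w₀ ∧ 2 * c / δ < w₀ ∧ 0 < w₀ :=
    ((eventually_gt_atTop _).and ((eventually_gt_atTop _).and ((eventually_gt_atTop _).and
      (eventually_gt_atTop _)))).exists
  have h12 : c / 2 ≤ 2 * c := by linarith
  let H : (ℝ →ᵇ ℝ) → ℝ → ℝ := fun z t => (Set.projIcc (c / 2) (2 * c) h12 (c + z t) : ℝ)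
  have hHc : ∀ z, Continuous (H z) := fun z =>
    continuous_subtype_val.comp (continuous_projIcc.comp (by fun_prop))
  have hHmem : ∀ z t, H z t ∈ Set.Icc (c / 2) (2 * c) := fun z t => Subtype.prop _
  let W : (ℝ →ᵇ ℝ) → ℝ → ℝ := fun z t => w₀ + ∫ s in (0 : ℝ)..t, H z s
  have hWd : ∀ z t, HasDerivAt (W z) (H z t) t := fun z t =>
    ((hHc z).integral_hasStrictDerivAt 0 t).hasDerivAt.const_add w₀
  have hWc : ∀ z, Continuous (W z) := fun z =>
    continuous_iff_continuousAt.2 fun t => (hWd z t).continuousAt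
  have hWge : ∀ z t, 0 ≤ t → w₀ + c / 2 * t ≤ W z t := by
    intro z t ht
    have := intervalIntegral.integral_mono_on (μ := MeasureTheory.volume) ht
      (continuous_const.intervalIntegrable 0 t) ((hHc z).intervalIntegrable 0 t) fun s _ => (hHmem z s).1
    rw [intervalIntegral.integral_const, smul_eq_mul] at this
    simp only [W]
    linarith
  have hWge' : ∀ z t, 0 ≤ t → w₀ ≤ W z t := fun z t ht => by
    have : 0 ≤ c / 2 * t := by positivity
    linarith [hWge z t ht]
  have hWlip : ∀ z y t, 0 ≤ t → |W z t - W y t| ≤ ‖z - y‖ * t := by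
    intro z y t ht
    have e : W z t - W y t = ∫ s in (0 : ℝ)..t, (H z s - H y s) := by
      rw [intervalIntegral.integral_sub ((hHc z).intervalIntegrable 0 t)
        ((hHc y).intervalIntegrable 0 t)]
      simp only [W]
      ring
    rw [e]
    have := intervalIntegral.norm_integral_le_of_norm_le_const (a := 0) (b := t)
      (f := fun s => H z s - H y s) (C := ‖z - y‖) fun s _ => ?_
    · rwa [sub_zero, abs_of_nonneg ht] at this
    · refine (abs_projIcc_sub_projIcc_le h12 _ _).trans ?_
      rw [add_sub_add_left_eq_sub]
      exact (z - y).norm_coe_le_norm s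
  have hFb : ∀ z t, ‖(m + 1) * (H z (max t 0) ^ 2 / W z (max t 0))‖ ≤
      (m + 1) * (4 * c ^ 2) / w₀ := by
    intro z t
    have h1 := hHmem z (max t 0)
    have h2 := hWge' z _ (le_max_right t 0)
    have h3 : 0 < W z (max t 0) := hw₀.trans_le h2
    rw [Real.norm_of_nonneg (by positivity), mul_div_assoc]
    refine mul_le_mul_of_nonneg_left (div_le_div₀ (by positivity) ?_ hw₀ h2) (by positivity)
    have := pow_le_pow_left₀ (by linarith [h1.1]) h1.2 2
    linarith
  let F : (ℝ →ᵇ ℝ) → (ℝ →ᵇ ℝ) := fun z => BoundedContinuousFunction.ofNormedAddCommGroup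
    (fun t => (m + 1) * (H z (max t 0) ^ 2 / W z (max t 0)))
    (by
      have h1 : Continuous fun t => H z (max t 0) := (hHc z).comp (by fun_prop)
      have h2 : Continuous fun t => W z (max t 0) := (hWc z).comp (by fun_prop)
      exact continuous_const.mul ((h1.pow 2).div h2 fun t =>
        (hw₀.trans_le (hWge' z _ (le_max_right t 0))).ne')) _ (hFb z)
  have hFlip : ∀ z y, ‖F z - F y‖ ≤ (m + 1) * (12 * c) / w₀ * ‖z - y‖ := by
    intro z y
    refine (BoundedContinuousFunction.norm_le (by positivity)).2 fun t => ?_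
    have e : (F z - F y) t = (m + 1) * (H z (max t 0) ^ 2 / W z (max t 0) -
        H y (max t 0) ^ 2 / W y (max t 0)) := by
      simp only [F, BoundedContinuousFunction.coe_sub, Pi.sub_apply,
        BoundedContinuousFunction.coe_ofNormedAddCommGroup]
      ring
    rw [e, norm_mul, Real.norm_of_nonneg (by positivity)]
    have ht := le_max_right t (0 : ℝ)
    have h1 : |H z (max t 0) - H y (max t 0)| ≤ ‖z - y‖ := by
      refine (abs_projIcc_sub_projIcc_le h12 _ _).trans ?_
      rw [add_sub_add_left_eq_sub]
      exact (z - y).norm_coe_le_norm _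
    have := abs_sq_div_sub_sq_div_le hc hw₀ ht (hHmem z _) (hHmem y _) (hWge z _ ht)
      (hWge y _ ht) h1 (hWlip z y _ ht)
    refine (mul_le_mul_of_nonneg_left this (show 0 ≤ m + 1 by positivity)).trans_eq ?_
    ring
  obtain ⟨z, hz, hzn⟩ := exists_bounded_solution_of_lipschitz hd.ne'
    (L := (m + 1) * (12 * c) / w₀) (by
      rw [abs_of_pos hd, div_lt_iff₀ hw₀]
      rwa [div_lt_iff₀' hd] at hw2) hFlip
  have hzb : ∀ t, |z t| ≤ c / 2 := by
    intro t
    refine (z.norm_coe_le_norm t).trans (hzn.trans ?_)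
    rw [abs_of_pos hd, div_le_iff₀ hd]
    refine (BoundedContinuousFunction.norm_ofNormedAddCommGroup_le _ (by positivity)
      (hFb z)).trans ?_
    rw [div_le_iff₀ hw₀]
    rw [div_lt_iff₀ (by positivity)] at hw1
    linarith
  have hH : ∀ t, H z t = c + z t := by
    intro t
    have h := abs_le.1 (hzb t)
    simp only [H]
    rw [Set.projIcc_of_mem h12 ⟨by linarith, by linarith⟩]
  have hpos : ∀ t, 0 < t → 0 < W z t := fun t ht => hw₀.trans_le (hWge' z t ht.le)
  refine ⟨W z, H z, fun t _ => hWd z t, fun t ht => ?_, hpos,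
    fun t _ => (half_pos hc).trans_le (hHmem z t).1, fun t _ => (hHmem z t).2, fun t ht => ?_⟩
  · have h1 : HasDerivAt (H z) (d * z t + F z t) t := by
      rw [show H z = fun t => c + z t from funext hH]
      exact (hz t).const_add c
    refine h1.congr_deriv ?_
    have e1 : F z t = (m + 1) * (H z t ^ 2 / W z t) := by
      simp only [F, BoundedContinuousFunction.coe_ofNormedAddCommGroup, max_eq_left ht.le]
    have e2 : d * c = 1 / m := by
      rw [hcdef]
      field_simp
    rw [e1, ← e2, hH t]
    ring
  · refine (hHmem z t).2.trans ?_
    rw [div_lt_iff₀ hδ] at hw3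
    have := mul_le_mul_of_nonneg_left (hWge' z t ht.le) hδ.le
    linarith

/-- Such a solution has slope `1/(dm)` at infinity: `q - d w + t/m` is increasing, and becomes
decreasing after subtraction of a multiple of `log w`, so that `d w - t/m = O(log t)`. -/
theorem tendsto_div_of_solution {d m Q : ℝ} (hd : 0 < d) (hm : 0 < m) {w q : ℝ → ℝ}
    (h₁ : ∀ t, 0 < t → HasDerivAt w (q t) t)
    (h₂ : ∀ t, 0 < t → HasDerivAt q (d * q t - 1 / m + (m + 1) * (q t ^ 2 / w t)) t)
    (hw : ∀ t, 0 < t → 0 < w t) (hq : ∀ t, 0 < t → 0 < q t) (hQ : ∀ t, 0 < t → q t ≤ Q) :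
    Tendsto (fun t => w t / t) atTop (𝓝 (1 / (d * m))) := by
  set A : ℝ → ℝ := fun t => q t - d * w t + t / m with hA
  have hQ0 : 0 < Q := (hq 1 one_pos).trans_le (hQ 1 one_pos)
  have hAd : ∀ t, 0 < t → HasDerivAt A ((m + 1) * (q t ^ 2 / w t)) t := by
    intro t ht
    refine (((h₂ t ht).sub ((h₁ t ht).const_mul d)).add
      ((hasDerivAt_id t).div_const m)).congr_deriv ?_
    ring
  set C : ℝ := (m + 1) * Q with hC
  have hC0 : 0 < C := by positivity
  have hBd : ∀ t, 0 < t → HasDerivAt (fun t => C * Real.log (w t) - A t)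
      (C * (q t / w t) - (m + 1) * (q t ^ 2 / w t)) t := fun t ht =>
    (((h₁ t ht).log (hw t ht).ne').const_mul C).sub (hAd t ht)
  have hmono : ∀ {f f' : ℝ → ℝ}, (∀ t, 0 < t → HasDerivAt f (f' t) t) →
      (∀ t, 0 < t → 0 ≤ f' t) → ∀ t, 1 ≤ t → f 1 ≤ f t := by
    intro f f' hf hf' t ht
    refine monotoneOn_of_hasDerivWithinAt_nonneg (convex_Ici 1)
      (fun s hs => (hf s (one_pos.trans_le hs)).continuousAt.continuousWithinAt)
      (fun s hs => (hf s ?_).hasDerivWithinAt) (fun s hs => hf' s ?_) Set.self_mem_Ici ht ht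
    all_goals
      rw [interior_Ici] at hs
      exact one_pos.trans hs
  have hlow := hmono hAd fun t ht => by
    have := hw t ht
    positivity
  have hup := hmono hBd fun t ht => by
    have h1 : C * (q t / w t) - (m + 1) * (q t ^ 2 / w t) =
        (m + 1) * (q t / w t) * (Q - q t) := by
      rw [hC]
      ring
    rw [h1]
    have := hw t ht
    have := hq t ht
    exact mul_nonneg (by positivity) (sub_nonneg.2 (hQ t ht))
  have hwle := hmono (f := fun t => Q * t - w t) (f' := fun t => Q - q t)
    (fun t ht => (((hasDerivAt_id t).const_mul Q).sub (h₁ t ht)).congr_deriv (by simp))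
    fun t ht => sub_nonneg.2 (hQ t ht)
  have hlogle : ∀ t, 1 ≤ t → Real.log (w t) ≤ Real.log (w 1 + Q) + Real.log t := by
    intro t ht
    have h1 := hw 1 one_pos
    rw [← Real.log_mul (by positivity) (by positivity)]
    refine Real.log_le_log (hw t (by linarith)) ?_
    have := hwle t ht
    nlinarith
  have hinv : ∀ a : ℝ, Tendsto (fun t : ℝ => a / t) atTop (𝓝 0) := fun a =>
    tendsto_const_nhds.div_atTop tendsto_id
  have hlog : Tendsto (fun t : ℝ => Real.log t / t) atTop (𝓝 0) := by
    simpa using Real.tendsto_pow_log_div_mul_add_atTop 1 0 1 one_ne_zero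
  have hA0 : Tendsto (fun t => A t / t) atTop (𝓝 0) := by
    have hub : Tendsto (fun t : ℝ => (C * Real.log (w 1 + Q) - (C * Real.log (w 1) - A 1)) / t +
        C * (Real.log t / t)) atTop (𝓝 0) := by
      simpa using (hinv _).add (hlog.const_mul C)
    refine tendsto_of_tendsto_of_tendsto_of_le_of_le' (hinv (A 1)) hub ?_ ?_
    · filter_upwards [eventually_ge_atTop 1] with t ht
      exact div_le_div_of_nonneg_right (hlow t ht) (by linarith)
    · filter_upwards [eventually_ge_atTop 1] with t ht
      rw [mul_div_assoc', ← add_div]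
      refine div_le_div_of_nonneg_right ?_ (by linarith)
      have h1 := hup t ht
      have h2 := mul_le_mul_of_nonneg_left (hlogle t ht) hC0.le
      linarith
  have hq0 : Tendsto (fun t => q t / t) atTop (𝓝 0) := by
    refine tendsto_of_tendsto_of_tendsto_of_le_of_le' tendsto_const_nhds (hinv Q) ?_ ?_
    · filter_upwards [eventually_gt_atTop 0] with t ht
      exact (div_pos (hq t ht) ht).le
    · filter_upwards [eventually_gt_atTop 0] with t ht
      exact div_le_div_of_nonneg_right (hQ t ht) ht.le
  have hfin : Tendsto (fun t => (q t / t + 1 / m - A t / t) / d) atTop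
      (𝓝 ((0 + 1 / m - 0) / d)) := ((hq0.add_const _).sub hA0).div_const d
  have e : (0 + 1 / m - 0) / d = 1 / (d * m) := by field_simp; ring
  rw [e] at hfin
  refine hfin.congr' ?_
  filter_upwards [eventually_gt_atTop 0] with t ht
  simp only [hA]
  field_simp
  ring

/-- At the critical exponent `(p - 1) τ = 2` the substitution `φ = w^{-m}`, `m = τ/2`, turns
`φ'' = d φ' + φ^p` into `w'' = d w' - 1/m + (m+1) w'²/w`. -/
theorem exists_isPositiveRadialSolution_log_rate {N k : ℕ} (hk : 0 < k) (hkN : k ≤ N) {μ p τ : ℝ}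
    (hτ : 0 < τ) (hroot : τ ^ 2 - (k - 2) * τ + μ = 0) (hcrit : (p - 1) * τ = 2)
    (hd : 0 < (k : ℝ) - 2 - 2 * τ) :
    ∃ u : ℝ → ℝ, IsPositiveRadialSolution N k μ p u ∧
      Tendsto (fun r : ℝ => r ^ τ * (-Real.log r) ^ (τ / 2) * u r) (𝓝[>] 0)
        (𝓝 ((((k : ℝ) - 2 - 2 * τ) * (τ / 2)) ^ (τ / 2))) := by
  set d : ℝ := k - 2 - 2 * τ with hddef
  set m : ℝ := τ / 2 with hm
  have hm0 : 0 < m := by positivity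
  have hτm : τ = 2 * m := by rw [hm]; ring
  -- `δ` is small enough for `u'' ≥ u'/r` to follow from `|φ'| ≤ m δ φ`.
  set δ : ℝ := (τ ^ 2 + 2 * τ) / (m * (d + (2 * τ + 2))) with hδ
  obtain ⟨w, q, h1, h2, h3, h4, h5, h6⟩ :=
    exists_solution_near_linear (δ := δ) hd hm0 (by positivity)
  have hlim := tendsto_div_of_solution hd hm0 h1 h2 h3 h4 h5
  have hs : ∀ t, 0 < t → ∀ a : ℝ, w t ^ (a - 1) = w t ^ a * (w t)⁻¹ := fun t ht a => by
    rw [Real.rpow_sub_one (h3 t ht).ne', div_eq_mul_inv]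
  have hpow : ∀ t, 0 < t → (w t ^ (-m)) ^ p = w t ^ (-m) * (w t)⁻¹ := by
    intro t ht
    rw [← hs t ht, ← Real.rpow_mul (h3 t ht).le]
    congr 1
    rw [hτm] at hcrit
    linarith
  refine ⟨fun r => r ^ (-τ) * w (-Real.log r) ^ (-m), ?_, ?_⟩
  · refine isPositiveRadialSolution_of_log hk hkN (φ := fun t => w t ^ (-m))
      (φ₁ := fun t => -m * (w t ^ (-m - 1) * q t))
      (φ₂ := fun t => d * (-m * (w t ^ (-m - 1) * q t)) + w t ^ (-m - 1)) ?_ ?_ ?_ ?_ ?_ ?_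
    · intro t ht
      refine ((h1 t ht).rpow_const (Or.inl (h3 t ht).ne')).congr_deriv ?_
      ring
    · intro t ht
      refine ((((h1 t ht).rpow_const (p := -m - 1) (Or.inl (h3 t ht).ne')).mul
        (h2 t ht)).const_mul (-m)).congr_deriv ?_
      simp only [hs t ht]
      have := (h3 t ht).ne'
      field_simp
      ring
    · have c0 : ContinuousOn w (Set.Ioi 0) := fun t h =>
        (h1 t h).continuousAt.continuousWithinAt
      have c1 : ContinuousOn q (Set.Ioi 0) := fun t h =>
        (h2 t h).continuousAt.continuousWithinAt
      have c2 : ContinuousOn (fun t => w t ^ (-m - 1)) (Set.Ioi 0) :=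
        c0.rpow_const fun t ht => Or.inl (h3 t ht).ne'
      exact (continuousOn_const.mul (continuousOn_const.mul (c2.mul c1))).add c2
    · exact fun t ht => Real.rpow_pos_of_pos (h3 t ht) _
    · intro t ht
      have hwt := h3 t ht
      have hP := Real.rpow_pos_of_pos hwt (-m)
      have e1 : m * (d + (2 * τ + 2)) * q t ≤ (τ ^ 2 + 2 * τ) * w t := by
        have := mul_le_mul_of_nonneg_left (h6 t ht)
          (show 0 ≤ m * (d + (2 * τ + 2)) by positivity)
        refine this.trans_eq ?_
        rw [hδ]
        field_simp
      have e2 : 0 ≤ w t ^ (-m) * (w t)⁻¹ *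
          ((τ ^ 2 + 2 * τ) * w t - m * (d + (2 * τ + 2)) * q t + 1) :=
        mul_nonneg (by positivity) (by linarith)
      refine e2.trans_eq ?_
      simp only [hs t ht]
      field_simp
      ring
    · intro t ht
      rw [hroot, hpow t ht, hcrit, ← hddef]
      simp only [hs t ht, sub_self, neg_zero, zero_mul, Real.exp_zero]
      ring
  · have hlim' : Tendsto (fun t => (w t / t) ^ (-m)) atTop (𝓝 ((1 / (d * m)) ^ (-m))) :=
      hlim.rpow_const (Or.inl (by positivity))
    have e : (1 / (d * m)) ^ (-m) = (d * m) ^ m := by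
      rw [one_div, Real.inv_rpow (by positivity), Real.rpow_neg (by positivity), inv_inv]
    rw [e] at hlim'
    refine (hlim'.comp tendsto_neg_log_nhdsGT_zero).congr' ?_
    filter_upwards [self_mem_nhdsWithin, Ioo_mem_nhdsGT one_pos] with r hr hr1
    have ht : 0 < -Real.log r := neg_pos.2 (Real.log_neg hr1.1 hr1.2)
    have h7 : r ^ τ * r ^ (-τ) = 1 := by
      rw [← Real.rpow_add hr]
      simp
    simp only [Function.comp]
    rw [Real.div_rpow (h3 _ ht).le ht.le, Real.rpow_neg ht.le m, div_inv_eq_mul]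
    linear_combination (-(-Real.log r) ^ m * w (-Real.log r) ^ (-m)) * h7

/-! ### Existence in the four ranges of `p` -/

theorem tauMinus_lt_tauPlus {k : ℕ} {μ : ℝ} (hμk : μ < (((k : ℝ) - 2) / 2) ^ 2) :
    tauMinus k μ < tauPlus k μ := by
  have := Real.sqrt_pos.2 (sub_pos.2 hμk)
  unfold tauMinus tauPlus
  linarith

theorem tauMinus_pos {k : ℕ} {μ : ℝ} (hk : 3 ≤ k) (hμ : 0 < μ) : 0 < tauMinus k μ := by
  have hk' : (3 : ℝ) ≤ k := by exact_mod_cast hk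
  have : √((((k : ℝ) - 2) / 2) ^ 2 - μ) < ((k : ℝ) - 2) / 2 := by
    rw [Real.sqrt_lt' (by linarith)]
    linarith
  unfold tauMinus
  linarith

/-- `τ⁺` and `τ⁻` are the roots of the indicial polynomial. -/
theorem sub_tauPlus_mul_sub_tauMinus {k : ℕ} {μ : ℝ} (hμk : μ < (((k : ℝ) - 2) / 2) ^ 2) (x : ℝ) :
    (x - tauPlus k μ) * (x - tauMinus k μ) = x ^ 2 - (k - 2) * x + μ := by
  have := Real.sq_sqrt (sub_pos.2 hμk).le
  unfold tauMinus tauPlus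
  linear_combination -this

/-- The homogeneous function `K r^{-2/(p-1)}` is itself a solution. -/
theorem exists_isPositiveRadialSolution_homogeneous {N k : ℕ} (hk : 0 < k) (hkN : k ≤ N)
    {μ p : ℝ} (hp : 1 < p) (hμk : μ < (((k : ℝ) - 2) / 2) ^ 2)
    (hpos : 0 < (2 / (p - 1) - tauPlus k μ) * (2 / (p - 1) - tauMinus k μ)) :
    ∃ u : ℝ → ℝ, IsPositiveRadialSolution N k μ p u ∧
      Tendsto (fun r : ℝ => r ^ (2 / (p - 1)) * u r) (𝓝[>] 0) (𝓝 (constK k μ p)) := by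
  have hp1 : 0 < p - 1 := by linarith
  have hK : 0 < constK k μ p := Real.rpow_pos_of_pos hpos _
  have hKp : constK k μ p ^ p =
      (2 / (p - 1) - tauPlus k μ) * (2 / (p - 1) - tauMinus k μ) * constK k μ p := by
    have e : constK k μ p ^ (p - 1) =
        (2 / (p - 1) - tauPlus k μ) * (2 / (p - 1) - tauMinus k μ) := by
      rw [constK, ← Real.rpow_mul hpos.le, one_div_mul_cancel hp1.ne', Real.rpow_one]
    rw [← e, Real.rpow_sub_one hK.ne']
    field_simp
  set τ : ℝ := 2 / (p - 1) with hτ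
  have hτ0 : 0 < τ := by positivity
  refine ⟨fun r => r ^ (-τ) * constK k μ p, ?_, ?_⟩
  · refine isPositiveRadialSolution_of_log hk hkN (φ := fun _ => constK k μ p) (φ₁ := fun _ => 0)
      (φ₂ := fun _ => 0) (fun t _ => hasDerivAt_const t _) (fun t _ => hasDerivAt_const t _)
      continuousOn_const (fun _ _ => hK) (fun t _ => ?_) (fun t _ => ?_)
    · have : 0 ≤ (τ ^ 2 + 2 * τ) * constK k μ p := by positivity
      linarith
    · have h0 : 2 - (p - 1) * τ = 0 := by
        rw [hτ]
        field_simp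
        ring
      rw [hKp, sub_tauPlus_mul_sub_tauMinus hμk, h0]
      simp
  · refine tendsto_const_nhds.congr' ?_
    filter_upwards [self_mem_nhdsWithin] with r hr
    rw [← mul_assoc, ← Real.rpow_add hr, add_neg_cancel, Real.rpow_zero, one_mul]

theorem mainTheorem3 (N k : ℕ) (hk : 3 ≤ k) (hkN : k < N) (μ p : ℝ) (hμ : 0 < μ)
    (hμk : μ < (((k : ℝ) - 2) / 2) ^ 2) (hp : 1 < p) :
    (p < pStar k μ →
      (∃ u : ℝ → ℝ, IsPositiveRadialSolution N k μ p u ∧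
        Tendsto (fun r : ℝ => r ^ (2 / (p - 1)) * u r) (𝓝[>] 0) (𝓝 (constK k μ p))) ∧
      (∃ (v : ℝ → ℝ) (c₁ : ℝ), IsPositiveRadialSolution N k μ p v ∧ 0 < c₁ ∧
        Tendsto (fun r : ℝ => r ^ tauPlus k μ * v r) (𝓝[>] 0) (𝓝 c₁)) ∧
      (∃ (w : ℝ → ℝ) (c₂ : ℝ), IsPositiveRadialSolution N k μ p w ∧ 0 < c₂ ∧
        Tendsto (fun r : ℝ => r ^ tauMinus k μ * w r) (𝓝[>] 0) (𝓝 c₂))) ∧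
    (pStar k μ ≤ p → p < pStarStar k μ →
      ∃ (u : ℝ → ℝ) (c₂ : ℝ), IsPositiveRadialSolution N k μ p u ∧ 0 < c₂ ∧
        Tendsto (fun r : ℝ => r ^ tauMinus k μ * u r) (𝓝[>] 0) (𝓝 c₂)) ∧
    (p = pStarStar k μ →
      ∃ u : ℝ → ℝ, IsPositiveRadialSolution N k μ p u ∧
        Tendsto (fun r : ℝ => r ^ tauMinus k μ * (-Real.log r) ^ (tauMinus k μ / 2) * u r)
          (𝓝[>] 0) (𝓝 (constKBar k μ))) ∧
    (pStarStar k μ < p →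
      ∃ u : ℝ → ℝ, IsPositiveRadialSolution N k μ p u ∧
        Tendsto (fun r : ℝ => r ^ (2 / (p - 1)) * u r) (𝓝[>] 0) (𝓝 (constK k μ p))) := by
  have hk0 : 0 < k := by omega
  have hp1 : 0 < p - 1 := by linarith
  have hlt := tauMinus_lt_tauPlus hμk
  have hm := tauMinus_pos hk hμ
  have hP : 0 < tauPlus k μ := hm.trans hlt
  have hrootP : tauPlus k μ ^ 2 - (k - 2) * tauPlus k μ + μ = 0 := by
    rw [← sub_tauPlus_mul_sub_tauMinus hμk, sub_self, zero_mul]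
  have hrootM : tauMinus k μ ^ 2 - (k - 2) * tauMinus k μ + μ = 0 := by
    rw [← sub_tauPlus_mul_sub_tauMinus hμk, sub_self, mul_zero]
  have hltP : p < pStar k μ ↔ (p - 1) * tauPlus k μ < 2 := by
    rw [pStar, ← sub_lt_iff_lt_add', lt_div_iff₀ hP]
  have hltM : p < pStarStar k μ ↔ (p - 1) * tauMinus k μ < 2 := by
    rw [pStarStar, ← sub_lt_iff_lt_add', lt_div_iff₀ hm]
  have hgtM : pStarStar k μ < p ↔ 2 < (p - 1) * tauMinus k μ := by
    rw [pStarStar, ← lt_sub_iff_add_lt', div_lt_iff₀ hm]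
  refine ⟨fun h => ?_, fun _ h => ?_, fun h => ?_, fun h => ?_⟩
  · have h' := hltP.1 h
    have h'' : (p - 1) * tauMinus k μ < 2 :=
      (mul_lt_mul_of_pos_left hlt hp1).trans h'
    refine ⟨exists_isPositiveRadialSolution_homogeneous hk0 hkN.le hp hμk (mul_pos ?_ ?_),
      exists_isPositiveRadialSolution_rate hk0 hkN.le hp hP hrootP h',
      exists_isPositiveRadialSolution_rate hk0 hkN.le hp hm hrootM h''⟩
    · rwa [sub_pos, lt_div_iff₀' hp1]
    · rwa [sub_pos, lt_div_iff₀' hp1]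
  · exact exists_isPositiveRadialSolution_rate hk0 hkN.le hp hm hrootM (hltM.1 h)
  · have hcrit : (p - 1) * tauMinus k μ = 2 := by
      rw [h, pStarStar, add_sub_cancel_left, div_mul_cancel₀ _ hm.ne']
    have hd : (k : ℝ) - 2 - 2 * tauMinus k μ = 2 * √((((k : ℝ) - 2) / 2) ^ 2 - μ) := by
      unfold tauMinus
      ring
    have hd0 : 0 < (k : ℝ) - 2 - 2 * tauMinus k μ := by
      rw [hd]
      have := Real.sqrt_pos.2 (sub_pos.2 hμk)
      positivity
    have e : ((k : ℝ) - 2 - 2 * tauMinus k μ) * (tauMinus k μ / 2) =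
        tauMinus k μ * √((((k : ℝ) - 2) / 2) ^ 2 - μ) := by
      rw [hd]
      ring
    have := exists_isPositiveRadialSolution_log_rate hk0 hkN.le hm hrootM hcrit hd0
    rwa [e] at this
  · have h' := hgtM.1 h
    refine exists_isPositiveRadialSolution_homogeneous hk0 hkN.le hp hμk
      (mul_pos_of_neg_of_neg ?_ ?_)
    · rw [sub_neg, div_lt_iff₀' hp1]
      exact h'.trans (mul_lt_mul_of_pos_left hlt hp1)
    · rwa [sub_neg, div_lt_iff₀' hp1]
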